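/- Let $t_{\max}\in\mathbb R$ and let $a\colon(-\infty,t_{\max})\to(0,\infty)$ be smooth. Let $(M,g)$ be the flat FLRW spacetime $M=(-\infty,t_{\max})\times\mathbb R^3$, $g=-dt^2+a(t)^2(dx^2+dy^2+dz^2)=-dt^2+a(t)^2(dr^2+r^2d\Omega^2)$, time oriented by $\partial_t$, where $d\Omega^2$ is the round metric of $\mathbb S^2$, and let $H=\dot a/a$. Suppose that for some real numbers $h>0$ and $b$, as $t\to-\infty$, $$a(t)=e^{ht}+be^{3ht}+o(e^{3ht}),\quad \dot a(t)=he^{ht}+3hbe^{3ht}+o(e^{3ht}),\quad \ddot a(t)=h^2e^{ht}+9h^2be^{3ht}+o(e^{3ht}).$$ Then $\dot H(t)/a(t)^2\to 4bh^2$ as $t\to-\infty$, and $(M,g)$ admits a $C^2$ extension through the hypersurface $\lambda=0$ in the following sense. Fix any $t_L<t_{\max}$ and put $$\lambda(t)=\int_{-\infty}^t a(s)\,ds,\qquad \eta(t)=-\int_t^{t_L}\frac{ds}{a(s)},\qquad v(t,r)=\eta(t)+r .$$ The part $r>0$ of $M$ is identified, through the coordinates $(\lambda,v,\omega)$, with $U\times\mathbb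 S^2$, where $U=\{(\lambda(t),\eta(t)+r) : t<t_{\max},\ r>0\}\subset\{\lambda>0\}$. Then there are a connected open set $V\subset\mathbb R\times\mathbb R\times\mathbb S^2$ with $\{0\}\times\mathbb R\times\mathbb S^2\subset V\subset (U\cup\{\lambda\le 0\})\times\mathbb S^2$, a $C^2$ Lorentzian metric $g_{\rm ext}$ on $V$ with $g_{\rm ext}=g$ on $V\cap(U\times\mathbb S^2)$, and a time orientation of $(V,g_{\rm ext})$, given by a continuous timelike vector field on $V$, that agrees on $V\cap(U\times\mathbb S^2)$ with the time orientation of $M$. -/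

import Mathlib

open Set Filter Topology Asymptotics MeasureTheory Bundle
open scoped Manifold ContDiff

namespace FLRW

noncomputable section

/-- Euclidean three-space. -/
abbrev E3 : Type := EuclideanSpace ℝ (Fin 3)

/-- The unit two-sphere in Euclidean three-space, with Mathlib's smooth structure. -/
abbrev S2 : Type := Metric.sphere (0 : E3) 1

/-- The four-dimensional smooth manifold `ℝ × ℝ × 𝕊²`.  It carries both the coordinates `(t, r, u)`
and the coordinates `(lam, v, u)`. -/
abbrev Cyl : Type := ℝ × ℝ × S2

/-- The model with corners (without boundary) of `ℝ × ℝ × 𝕊²`. -/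
abbrev ICyl := (𝓘(ℝ, ℝ)).prod ((𝓘(ℝ, ℝ)).prod (𝓡 2))

section Metric

variable {E : Type*} [NormedAddCommGroup E] [NormedSpace ℝ E]
  {Hm : Type*} [TopologicalSpace Hm] (I : ModelWithCorners ℝ E Hm)
  {N : Type*} [TopologicalSpace N] [ChartedSpace Hm N] [IsManifold I ∞ N]

/-- `g` is a `C^k` Lorentzian metric tensor on the subset `V` of the four-dimensional manifold `N`:
a `C^k` section over `V` of the bundle of bilinear forms on the tangent spaces, with Lorentzian
values.  Lorentzian means that some basis of the tangent space puts the form into the shape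
`diag (-1, 1, 1, 1)`; such a form is symmetric and nondegenerate. -/
structure IsLorentzianMetricOn (k : ℕ∞)
    (g : (p : N) → TangentSpace I p →L[ℝ] TangentSpace I p →L[ℝ] ℝ) (V : Set N) : Prop where
  contMDiffOn : ContMDiffOn I (I.prod 𝓘(ℝ, E →L[ℝ] E →L[ℝ] ℝ)) k
    (fun p : N => TotalSpace.mk' (E →L[ℝ] E →L[ℝ] ℝ)
      (E := fun p : N => TangentSpace I p →L[ℝ] TangentSpace I p →L[ℝ] ℝ) p (g p)) V
  lorentzian : ∀ p ∈ V, ∃ e : Module.Basis (Fin 4) ℝ (TangentSpace I p), ∀ i j : Fin 4,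
    g p (e i) (e j) = if i = j then (if i = 0 then -1 else 1) else 0

/-- `T` is a continuous vector field on `V`, timelike for the metric `g`.  Such a field is a time
orientation of `(V, g)`: it declares `T` to be future directed. -/
structure IsTimeOrientationOn
    (g : (p : N) → TangentSpace I p →L[ℝ] TangentSpace I p →L[ℝ] ℝ)
    (T : (p : N) → TangentSpace I p) (V : Set N) : Prop where
  continuousOn : ContinuousOn (fun p : N => TotalSpace.mk' E
    (E := fun p : N => TangentSpace I p) p (T p)) V
  timelike : ∀ p ∈ V, g p (T p) (T p) < 0

end Metric

/-- The flat FLRW metric `-dt² + a(t)² (dx² + dy² + dz²)` at the point `p = (t, x)` of `ℝ × ℝ³`,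
evaluated at two tangent vectors. -/
def flrwMetric (a : ℝ → ℝ) (p : ℝ × E3) (X Y : ℝ × E3) : ℝ :=
  -(X.1 * Y.1) + a p.1 ^ 2 * inner ℝ X.2 Y.2

/-- The Hubble parameter `H = ȧ / a`. -/
def hubble (a : ℝ → ℝ) (t : ℝ) : ℝ := deriv a t / a t

/-- The coordinate `lam(t) = ∫_{-∞}^t a`. -/
def lam (a : ℝ → ℝ) (t : ℝ) : ℝ := ∫ s in Iic t, a s

/-- Conformal time `η(t) = -∫_t^{tL} ds / a(s)`. -/
def conformalTime (a : ℝ → ℝ) (tL t : ℝ) : ℝ := -∫ s in t..tL, 1 / a s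

/-- Spherical coordinates on `ℝ × ℝ³`: the point `(t, r u)` with coordinates `(t, r, u)`. -/
def polar (q : Cyl) : ℝ × E3 := (q.1, q.2.1 • (q.2.2 : E3))

/-- The change of coordinates `(t, r, u) ↦ (lam(t), η(t) + r, u)`. -/
def toLamV (a : ℝ → ℝ) (tL : ℝ) (q : Cyl) : Cyl :=
  (lam a q.1, conformalTime a tL q.1 + q.2.1, q.2.2)

/-- The domain `t < tmax`, `r > 0` of the spherical coordinates on
`M = (-∞, tmax) × ℝ³`. -/
def sphDomain (tmax : ℝ) : Set Cyl := {q | q.1 < tmax ∧ 0 < q.2.1}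

/-- The flat FLRW spacetime `M = (-∞, tmax) × ℝ³`, `g = -dt² + a(t)² (dx² + dy² + dz²)`,
time oriented by `∂_t`, admits a `C^k` extension through the hypersurface `lam = 0`.

The hypersurface is `{0} × ℝ × 𝕊²` in the coordinates `(lam, v, u)`, in which the part `r > 0` of
`M` is the image of `sphDomain tmax` under `toLamV a tL` (this image lies in `lam > 0`), and to which
the whole region `lam ≤ 0` is attached.  There have to be a connected open neighbourhood `V` of the
hypersurface inside the union of these two regions, a `C^k` Lorentzian metric `gext` on `V`, and a
time orientation `T` of `(V, gext)`, such that on the common part of `M` and `V` the metric `gext`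
is the metric of `M` and `T` lies in the same half of the light cone as `∂_t`. -/
def AdmitsExtensionThroughLamZero (a : ℝ → ℝ) (tmax tL : ℝ) (k : ℕ∞) : Prop :=
  ∃ (V : Set Cyl)
    (gext : (p : Cyl) → TangentSpace ICyl p →L[ℝ] TangentSpace ICyl p →L[ℝ] ℝ)
    (T : (p : Cyl) → TangentSpace ICyl p),
    IsOpen V ∧ IsConnected V ∧
    (∀ (v : ℝ) (u : S2), ((0, v, u) : Cyl) ∈ V) ∧
    (∀ p ∈ V, 0 < p.1 → p ∈ toLamV a tL '' sphDomain tmax) ∧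
    IsLorentzianMetricOn ICyl k gext V ∧
    IsTimeOrientationOn ICyl gext T V ∧
    -- `gext` agrees with the FLRW metric on the common part of `M` and `V`
    (∀ q ∈ sphDomain tmax, toLamV a tL q ∈ V → ∀ X Y : TangentSpace ICyl q,
      gext (toLamV a tL q)
          (mfderiv ICyl ICyl (toLamV a tL) q X) (mfderiv ICyl ICyl (toLamV a tL) q Y) =
        flrwMetric a (polar q)
          (mfderiv ICyl 𝓘(ℝ, ℝ × E3) polar q X) (mfderiv ICyl 𝓘(ℝ, ℝ × E3) polar q Y)) ∧
    -- `T` and `∂_t` lie in the same half of the light cone; in the coordinates `(t, r, u)` the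
    -- field `∂_t` is `(1, 0, 0)`
    (∀ q ∈ sphDomain tmax, toLamV a tL q ∈ V →
      gext (toLamV a tL q) (T (toLamV a tL q))
        (mfderiv ICyl ICyl (toLamV a tL) q
          (((1 : ℝ), (0 : ℝ), (0 : EuclideanSpace ℝ (Fin 2))) : TangentSpace ICyl q)) < 0)

end

end FLRW

namespace FLRW

/-! ### Functions of `t` as regular functions of the variable `lm t` -/

section Extension

variable {tmax : ℝ} {a lm : ℝ → ℝ}

/-! Since dλ = a dt and dv = dt/a + dr, the FLRW metric becomes a² dv² - 2 dλ dv + (a r)² dΩ² with a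
r = a v - a η. Its coefficients involve only a and a η as functions of λ, and the form is Lorentzian
wherever a r > 0, whatever the value of a. So it suffices to extend a and a η to C² functions `A`,
`G` of λ across 0 with -`G 0` > 0 (`admitsExtension_of_contDiff`).

With d/dλ = a⁻¹ d/dt, the first derivatives are H and H η + 1/a, and the second derivatives are
(Ḣ/a²) a and (Ḣ/a²) (a η); in the latter the terms H/a cancel. The expansions give Ḣ/a² → 4bh²
(`tendsto_deriv_hubble_div`), a → 0 and a η → -1/h (`tendsto_mul_conformalTime`). Both second
derivatives therefore converge as λ → 0, and integrating their continuous extensions twice gives `A`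
and `G` (`exists_contDiff_two_extension`), with a r = 1/h on λ = 0. -/

lemma strictMonoOn_of_hasDerivAt (hlam : ∀ t < tmax, HasDerivAt lm (a t) t)
    (ha : ∀ t < tmax, 0 < a t) : StrictMonoOn lm (Iio tmax) := by
  refine strictMonoOn_of_deriv_pos (convex_Iio tmax)
    (fun t ht => (hlam t ht).continuousAt.continuousWithinAt) fun t ht => ?_
  rw [interior_Iio] at ht
  rw [(hlam t ht).deriv]
  exact ha t ht

lemma pos_of_tendsto_atBot (hlam : ∀ t < tmax, HasDerivAt lm (a t) t)
    (ha : ∀ t < tmax, 0 < a t) (hlim : Tendsto lm atBot (𝓝 0)) {t : ℝ} (ht : t < tmax) :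
    0 < lm t := by
  have hmono := strictMonoOn_of_hasDerivAt hlam ha
  have h1 : t - 1 < tmax := by linarith
  -- The limit only yields `0 ≤ lm (t - 1)`; strict monotonicity from `t - 1` to `t` makes it
  -- strict.
  refine lt_of_le_of_lt (b := lm (t - 1)) ?_ (hmono h1 ht (by linarith))
  refine le_of_tendsto hlim ?_
  filter_upwards [eventually_le_atBot (t - 1)] with s hs
  exact hmono.monotoneOn (lt_of_le_of_lt hs h1 : s < tmax) h1 hs

lemma exists_eq_of_lt (hlam : ∀ t < tmax, HasDerivAt lm (a t) t)
    (hlim : Tendsto lm atBot (𝓝 0)) {t x : ℝ} (ht : t < tmax) (hx : 0 < x) (hxt : x < lm t) :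
    ∃ s < t, lm s = x := by
  obtain ⟨s, hs, hst⟩ := ((hlim.eventually (gt_mem_nhds hx)).and (eventually_lt_atBot t)).exists
  have hc : ContinuousOn lm (Icc s t) := fun y hy =>
    (hlam y (lt_of_le_of_lt hy.2 ht)).continuousAt.continuousWithinAt
  obtain ⟨y, hy, hyx⟩ := intermediate_value_Icc hst.le hc ⟨hs.le, hxt.le⟩
  refine ⟨y, lt_of_le_of_ne hy.2 ?_, hyx⟩
  rintro rfl
  exact hxt.ne' hyx

/-- A function of `t` with a limit at `-∞` is a continuous function of the variable `lm t`, extended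
by its limit to nonpositive values of that variable. -/
lemma exists_continuous_extension (hlam : ∀ t < tmax, HasDerivAt lm (a t) t)
    (ha : ∀ t < tmax, 0 < a t) (hac : ContinuousOn a (Iio tmax))
    (hlim : Tendsto lm atBot (𝓝 0)) {f : ℝ → ℝ} {L : ℝ} (hf : ContinuousOn f (Iio tmax))
    (hfL : Tendsto f atBot (𝓝 L)) {t₁ : ℝ} (ht₁ : t₁ < tmax) :
    ∃ ψ : ℝ → ℝ, Continuous ψ ∧ ∀ t < t₁, ψ (lm t) = f t := by
  classical
  have hmono := strictMonoOn_of_hasDerivAt hlam ha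
  have hpos : ∀ t < tmax, 0 < lm t := fun t ht => pos_of_tendsto_atBot hlam ha hlim ht
  obtain ⟨φ, hφ0, hφ⟩ : ∃ φ : ℝ → ℝ, (∀ x ≤ 0, φ x = L) ∧ ∀ t < tmax, φ (lm t) = f t := by
    refine ⟨fun x => if 0 < x then f (Function.invFunOn lm (Iio tmax) x) else L,
      fun x hx => if_neg hx.not_gt, fun t ht => ?_⟩
    simp only [hpos t ht, if_true]
    rw [hmono.injOn.leftInvOn_invFunOn ht]
  -- Room beyond `t₁`, so that the endpoint `lm t₁` is also reached from the interior.
  obtain ⟨t₂, ht₁₂, ht₂⟩ := exists_between ht₁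
  have hcont : ∀ x ≤ lm t₁, ContinuousAt φ x := by
    intro x hx
    rcases lt_trichotomy x 0 with hx0 | rfl | hx0
    · have : φ =ᶠ[𝓝 x] fun _ => L := by
        filter_upwards [gt_mem_nhds hx0] with y hy using hφ0 y hy.le
      exact continuousAt_const.congr this.symm
    · rw [Metric.continuousAt_iff']
      intro ε hε
      rw [hφ0 0 le_rfl]
      obtain ⟨T, hT⟩ := eventually_atBot.1 (Metric.tendsto_nhds.1 hfL ε hε)
      have hT' : min T t₁ < tmax := lt_of_le_of_lt (min_le_right _ _) ht₁
      filter_upwards [gt_mem_nhds (hpos _ hT')] with y hy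
      rcases le_or_gt y 0 with hy0 | hy0
      · rw [hφ0 y hy0, dist_self]
        exact hε
      · obtain ⟨s, hs, rfl⟩ := exists_eq_of_lt hlam hlim hT' hy0 hy
        rw [hφ s (hs.trans hT')]
        exact hT s (hs.le.trans (min_le_left _ _))
    · have : x < lm t₂ := lt_of_le_of_lt hx (hmono ht₁ ht₂ ht₁₂)
      obtain ⟨s, hs, rfl⟩ := exists_eq_of_lt hlam hlim ht₂ hx0 this
      have hs' : s < tmax := hs.trans ht₂
      have hstrict : HasStrictDerivAt lm (a s) s :=
        hasStrictDerivAt_of_hasDerivAt_of_continuousAt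
          (by filter_upwards [Iio_mem_nhds hs'] with t ht using hlam t ht)
          (hac.continuousAt (Iio_mem_nhds hs'))
      -- As `a s ≠ 0`, `lm` maps neighbourhoods of `s` onto neighbourhoods of `lm s`, so continuity
      -- of `φ` at `lm s` is continuity of `f` at `s`.
      rw [ContinuousAt, ← hstrict.map_nhds_eq (ha s hs').ne', tendsto_map'_iff, hφ s hs']
      refine (hf.continuousAt (Iio_mem_nhds hs')).congr' ?_
      filter_upwards [Iio_mem_nhds hs'] with t ht using (hφ t ht).symm
  -- Truncation freezes the function beyond `lm t₁`: outside the range of `lm` the inverse takes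
  -- junk values, and `f` need not converge at `tmax`.
  refine ⟨fun x => φ (min x (lm t₁)), continuous_iff_continuousAt.2 fun x => ?_, fun t ht => ?_⟩
  · exact ContinuousAt.comp (f := fun x => min x (lm t₁)) (hcont _ (min_le_right _ _))
      (by fun_prop)
  · simp only
    rw [min_eq_left (hmono (ht.trans ht₁) ht₁ ht).le, hφ t (ht.trans ht₁)]

/-- If `f`, as a function of the variable `lm t`, has second derivative `f₂`, and `f₂` has a limit
at `-∞`, then `f` is the restriction of a `C²` function of that variable. -/
lemma exists_contDiff_two_extension (hlam : ∀ t < tmax, HasDerivAt lm (a t) t)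
    (ha : ∀ t < tmax, 0 < a t) (hac : ContinuousOn a (Iio tmax))
    (hlim : Tendsto lm atBot (𝓝 0)) {f f₁ f₂ : ℝ → ℝ} {L : ℝ}
    (hf : ∀ t < tmax, HasDerivAt f (f₁ t * a t) t)
    (hf₁ : ∀ t < tmax, HasDerivAt f₁ (f₂ t * a t) t)
    (hf₂ : ContinuousOn f₂ (Iio tmax)) (hL : Tendsto f₂ atBot (𝓝 L)) {t₁ : ℝ} (ht₁ : t₁ < tmax) :
    ∃ F : ℝ → ℝ, ContDiff ℝ 2 F ∧ ∀ t < t₁, F (lm t) = f t := by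
  obtain ⟨ψ, hψ, hψf⟩ := exists_continuous_extension hlam ha hac hlim hf₂ hL ht₁
  have ht₀ : t₁ - 1 < t₁ := by linarith
  -- Uniqueness of primitives on `Iio t₁`, normalised at the base point `t₁ - 1`; it identifies the
  -- iterated integrals of `ψ` with `f₁` and then `f`.
  have key : ∀ {p q : ℝ → ℝ} {c : ℝ → ℝ}, (∀ t < t₁, HasDerivAt p (c t) t) →
      (∀ t < t₁, HasDerivAt q (c t) t) → p (t₁ - 1) = q (t₁ - 1) → ∀ t < t₁, p t = q t := by
    intro p q c hp hq h0 t ht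
    refine isOpen_Iio.eqOn_of_deriv_eq isPreconnected_Iio
      (fun s hs => (hp s hs).differentiableAt.differentiableWithinAt)
      (fun s hs => (hq s hs).differentiableAt.differentiableWithinAt)
      (fun s hs => by rw [(hp s hs).deriv, (hq s hs).deriv]) (show t₁ - 1 ∈ Iio t₁ from ht₀) h0 ht
  set F₁ : ℝ → ℝ := fun x => f₁ (t₁ - 1) + ∫ s in lm (t₁ - 1)..x, ψ s with hF₁
  have hdF₁ : ∀ x, HasDerivAt F₁ (ψ x) x := fun x =>
    (intervalIntegral.integral_hasDerivAt_right (hψ.intervalIntegrable _ _)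
      (hψ.stronglyMeasurableAtFilter _ _) hψ.continuousAt).const_add _
  have hF₁c : Continuous F₁ := continuous_iff_continuousAt.2 fun x => (hdF₁ x).continuousAt
  set F : ℝ → ℝ := fun x => f (t₁ - 1) + ∫ s in lm (t₁ - 1)..x, F₁ s with hF
  have hdF : ∀ x, HasDerivAt F (F₁ x) x := fun x =>
    (intervalIntegral.integral_hasDerivAt_right (hF₁c.intervalIntegrable _ _)
      (hF₁c.stronglyMeasurableAtFilter _ _) hF₁c.continuousAt).const_add _
  have hF₁eq : ∀ t < t₁, F₁ (lm t) = f₁ t := by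
    refine key (c := fun t => f₂ t * a t) (fun t ht => ?_) (fun t ht => hf₁ t (ht.trans ht₁))
      (by simp [hF₁])
    rw [← hψf t ht]
    exact (hdF₁ _).comp t (hlam t (ht.trans ht₁))
  refine ⟨F, ?_, ?_⟩
  · have e1 : deriv F = F₁ := funext fun x => (hdF x).deriv
    have e2 : deriv F₁ = ψ := funext fun x => (hdF₁ x).deriv
    rw [show (2 : WithTop ℕ∞) = 1 + 1 by norm_num, contDiff_succ_iff_deriv]
    refine ⟨fun x => (hdF x).differentiableAt, by simp, ?_⟩
    rw [e1, contDiff_one_iff_deriv, e2]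
    exact ⟨fun x => (hdF₁ x).differentiableAt, hψ⟩
  · refine key (c := fun t => f₁ t * a t) (fun t ht => ?_) (fun t ht => hf t (ht.trans ht₁))
      (by simp [hF])
    rw [← hF₁eq t ht]
    exact (hdF _).comp t (hlam t (ht.trans ht₁))

end Extension

/-! ### Consequences of the expansion; the functions λ and η -/

section Asymptotics

variable {a : ℝ → ℝ} {h : ℝ}

lemma tendsto_exp_mul_atBot (hh : 0 < h) : Tendsto (fun t => Real.exp (h * t)) atBot (𝓝 0) :=
  Real.tendsto_exp_atBot.comp (tendsto_id.const_mul_atBot hh)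

lemma tendsto_mul_exp_mul_atBot (hh : 0 < h) :
    Tendsto (fun t => t * Real.exp (h * t)) atBot (𝓝 0) := by
  have h1 : Tendsto (fun t : ℝ => -(h * t)) atBot atTop :=
    tendsto_neg_atBot_atTop.comp (tendsto_id.const_mul_atBot hh)
  have h2 := ((Real.tendsto_pow_mul_exp_neg_atTop_nhds_zero 1).comp h1).const_mul (-h⁻¹)
  rw [mul_zero] at h2
  refine h2.congr fun t => ?_
  simp only [Function.comp_apply, pow_one, neg_neg]
  field_simp

/-- With x = exp(h t) the error scale is x³, so each expansion becomes an exact polynomial identity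
in x with a coefficient tending to a constant. Later limits reduce to algebra. -/
lemma exists_remainder {f : ℝ → ℝ} {c d : ℝ}
    (hf : (fun t => f t - (c * Real.exp (h * t) + d * Real.exp (3 * h * t)))
      =o[atBot] fun t => Real.exp (3 * h * t)) :
    ∃ ε : ℝ → ℝ, Tendsto ε atBot (𝓝 0) ∧
      ∀ t, f t = c * Real.exp (h * t) + (d + ε t) * Real.exp (h * t) ^ 3 := by
  refine ⟨_, hf.tendsto_div_nhds_zero, fun t => ?_⟩
  have h3 : Real.exp (3 * h * t) = Real.exp (h * t) ^ 3 := by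
    rw [← Real.exp_nat_mul]
    congr 1
    push_cast
    ring
  have := Real.exp_pos (h * t)
  rw [h3]
  field_simp
  ring

variable {c d : ℝ} (hh : 0 < h)
  (hf : (fun t => a t - (c * Real.exp (h * t) + d * Real.exp (3 * h * t)))
      =o[atBot] fun t => Real.exp (3 * h * t))
include hh hf

lemma tendsto_div_exp : Tendsto (fun t => a t / Real.exp (h * t)) atBot (𝓝 c) := by
  obtain ⟨ε, hε, he⟩ := exists_remainder hf
  have h1 := (((hε.const_add d).mul ((tendsto_exp_mul_atBot hh).pow 2)).const_add c)
  have h2 : c + (d + 0) * 0 ^ 2 = c := by ring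
  rw [h2] at h1
  refine h1.congr fun t => ?_
  have := Real.exp_pos (h * t)
  rw [he t]
  field_simp

lemma tendsto_zero_of_expansion : Tendsto a atBot (𝓝 0) := by
  have h1 := (tendsto_div_exp hh hf).mul (tendsto_exp_mul_atBot hh)
  rw [mul_zero] at h1
  exact h1.congr fun t => div_mul_cancel₀ _ (Real.exp_pos _).ne'

lemma integrableOn_Iic_of_expansion {tmax t : ℝ} (hac : ContinuousOn a (Iio tmax))
    (ht : t < tmax) : IntegrableOn a (Iic t) := by
  have hloc : LocallyIntegrableOn a (Iic t) :=
    (hac.mono fun s hs => lt_of_le_of_lt hs ht).locallyIntegrableOn measurableSet_Iic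
  refine hloc.integrableOn_of_isBigO_atBot (g := fun t => Real.exp (h * t)) ?_
    ⟨Iic t, Iic_mem_atBot t, integrableOn_exp_mul_Iic hh t⟩
  refine isBigO_of_div_tendsto_nhds ?_ c (tendsto_div_exp hh hf)
  exact Eventually.of_forall fun t ht => absurd ht (Real.exp_pos _).ne'

omit hh hf in
lemma hasDerivAt_lam {tmax t : ℝ} (hac : ContinuousOn a (Iio tmax))
    (hint : ∀ t < tmax, IntegrableOn a (Iic t)) (ht : t < tmax) : HasDerivAt (lam a) (a t) t := by
  have ht' : t - 1 < tmax := by linarith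
  have hd : HasDerivAt (fun s => lam a (t - 1) + ∫ x in (t - 1)..s, a x) (a t) t := by
    refine (intervalIntegral.integral_hasDerivAt_right ?_ ?_
      (hac.continuousAt (Iio_mem_nhds ht))).const_add _
    · refine (hac.mono fun s hs => ?_).intervalIntegrable
      rw [uIcc_of_le (by linarith)] at hs
      exact lt_of_le_of_lt hs.2 ht
    · exact hac.stronglyMeasurableAtFilter isOpen_Iio t ht
  refine hd.congr_of_eventuallyEq ?_
  filter_upwards [Iio_mem_nhds ht] with s hs
  rw [← intervalIntegral.integral_Iic_sub_Iic (hint _ ht') (hint s hs)]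
  simp [lam]

omit hh hf in
lemma tendsto_lam_atBot {t : ℝ} (hint : IntegrableOn a (Iic t)) :
    Tendsto (lam a) atBot (𝓝 0) := by
  have h1 := (intervalIntegral_tendsto_integral_Iic t hint tendsto_id).const_sub (lam a t)
  rw [show lam a t - ∫ x in Iic t, a x = 0 from sub_self _] at h1
  refine h1.congr' ?_
  filter_upwards [eventually_le_atBot t] with s hs
  rw [id, ← intervalIntegral.integral_Iic_sub_Iic (hint.mono_set (Iic_subset_Iic.2 hs)) hint]
  simp [lam]

omit hh hf in
lemma hasDerivAt_conformalTime {tmax tL t : ℝ} (hac : ContinuousOn a (Iio tmax))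
    (ha : ∀ t < tmax, 0 < a t) (htL : tL < tmax) (ht : t < tmax) :
    HasDerivAt (conformalTime a tL) (1 / a t) t := by
  have hac' : ContinuousOn (fun s => 1 / a s) (Iio tmax) :=
    continuousOn_const.div hac fun s hs => (ha s hs).ne'
  have hd := (intervalIntegral.integral_hasDerivAt_left (a := t) (b := tL) ?_
    (hac'.stronglyMeasurableAtFilter isOpen_Iio t ht)
    (hac'.continuousAt (Iio_mem_nhds ht))).neg
  · rw [neg_neg] at hd
    exact hd
  · refine (hac'.mono fun s hs => ?_).intervalIntegrable
    exact lt_of_le_of_lt hs.2 (max_lt ht htL)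

end Asymptotics

/-! ### The limits of a η and Ḣ/a² -/

section Limits

variable {tmax : ℝ} {a : ℝ → ℝ} {h b : ℝ}

/-- The leading part of η is -exp(-h t)/h. The difference `q` has derivative 1/a - exp(-h t) → 0,
hence grows at most linearly as t → -∞, and the factor a ~ exp(h t) kills it. -/
lemma tendsto_mul_conformalTime {tL : ℝ} (hac : ContinuousOn a (Iio tmax))
    (ha : ∀ t < tmax, 0 < a t) (htL : tL < tmax) (hh : 0 < h)
    (ha0 : (fun t => a t - (1 * Real.exp (h * t) + b * Real.exp (3 * h * t)))
      =o[atBot] fun t => Real.exp (3 * h * t)) :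
    Tendsto (fun t => a t * conformalTime a tL t) atBot (𝓝 (-h⁻¹)) := by
  have hx := tendsto_exp_mul_atBot hh
  have hax := tendsto_div_exp hh ha0
  obtain ⟨ε, hε, he⟩ := exists_remainder ha0
  set q : ℝ → ℝ := fun t => conformalTime a tL t + h⁻¹ * Real.exp (-(h * t)) with hq
  have hqd : ∀ t < tmax, HasDerivAt q (1 / a t - Real.exp (-(h * t))) t := by
    intro t ht
    have h1 : HasDerivAt (fun t => -(h * t)) (-h) t := by
      simpa using (hasDerivAt_id t).const_mul (-h)
    refine ((hasDerivAt_conformalTime hac ha htL ht).add (h1.exp.const_mul h⁻¹)).congr_deriv ?_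
    field_simp
    ring
  have hq0 : Tendsto (fun t => 1 / a t - Real.exp (-(h * t))) atBot (𝓝 0) := by
    -- With x = exp(h t), 1/a - 1/x = (x - a)/(a x) = -(b + ε) x (a/x)⁻¹.
    have h1 := (((hε.const_add b).neg.mul hx).mul (hax.inv₀ one_ne_zero))
    rw [show -(b + 0) * 0 * (1 : ℝ)⁻¹ = 0 by ring] at h1
    refine h1.congr' ?_
    filter_upwards [eventually_lt_atBot tmax] with t ht
    have h2 := ha t ht
    have h3 := Real.exp_pos (h * t)
    have h4 := he t
    rw [Real.exp_neg]
    field_simp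
    linear_combination h4
  obtain ⟨T, hT⟩ := eventually_atBot.1 (Metric.tendsto_nhds.1 hq0 1 one_pos)
  obtain ⟨T', hT', hT'max⟩ : ∃ T' ≤ T, T' < tmax :=
    ⟨min T (tmax - 1), min_le_left _ _, lt_of_le_of_lt (min_le_right _ _) (by linarith)⟩
  have hbound : ∀ t ≤ T', |q t| ≤ |q T'| + (T' - t) := by
    intro t ht
    have h1 := (convex_Iic T').norm_image_sub_le_of_norm_hasDerivWithin_le (f := q)
      (f' := fun t => 1 / a t - Real.exp (-(h * t))) (C := 1) (x := T') (y := t)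
      (fun s hs => (hqd s (lt_of_le_of_lt hs hT'max)).hasDerivWithinAt)
      (fun s hs => by
        have := hT s (le_trans hs hT')
        rw [dist_zero_right] at this
        exact this.le) (mem_Iic.2 le_rfl) ht
    rw [Real.norm_eq_abs, Real.norm_eq_abs, one_mul, abs_of_nonpos (sub_nonpos.2 ht)] at h1
    have h2 := abs_sub_abs_le_abs_sub (q t) (q T')
    linarith
  have hxq : Tendsto (fun t => Real.exp (h * t) * q t) atBot (𝓝 0) := by
    have h1 := (hx.const_mul (|q T'| + T')).sub (tendsto_mul_exp_mul_atBot hh)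
    rw [mul_zero, sub_zero] at h1
    refine squeeze_zero_norm' ?_ h1
    filter_upwards [eventually_le_atBot T'] with t ht
    have h3 := Real.exp_pos (h * t)
    rw [Real.norm_eq_abs, abs_mul, abs_of_pos h3]
    nlinarith [hbound t ht]
  have h1 := hax.mul (hxq.sub_const h⁻¹)
  rw [one_mul, zero_sub] at h1
  refine h1.congr fun t => ?_
  have h3 := Real.exp_pos (h * t)
  simp only [hq, Real.exp_neg]
  field_simp
  ring

variable (hh : 0 < h) (hpos : ∀ t < tmax, 0 < a t)
  (ha0 : (fun t => a t - (1 * Real.exp (h * t) + b * Real.exp (3 * h * t)))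
      =o[atBot] fun t => Real.exp (3 * h * t))
  (ha1 : (fun t => deriv a t - (h * Real.exp (h * t) + 3 * h * b * Real.exp (3 * h * t)))
      =o[atBot] fun t => Real.exp (3 * h * t))
include hh hpos ha0 ha1

omit hh ha0 ha1 in
lemma hasDerivAt_hubble (hs : ContDiffOn ℝ ∞ a (Iio tmax)) {t : ℝ} (ht : t < tmax) :
    HasDerivAt a (deriv a t) t ∧ HasDerivAt (deriv a) (deriv (deriv a) t) t ∧
    HasDerivAt (hubble a) ((deriv (deriv a) t * a t - deriv a t ^ 2) / a t ^ 2) t := by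
  have h1 : HasDerivAt a (deriv a t) t :=
    ((hs.differentiableOn (by simp)).differentiableAt (Iio_mem_nhds ht)).hasDerivAt
  have hs' : ContDiffOn ℝ ∞ (deriv a) (Iio tmax) :=
    hs.deriv_of_isOpen isOpen_Iio (by simp)
  have h2 : HasDerivAt (deriv a) (deriv (deriv a) t) t :=
    ((hs'.differentiableOn (by simp)).differentiableAt (Iio_mem_nhds ht)).hasDerivAt
  refine ⟨h1, h2, (h2.div h1 (hpos t ht).ne').congr_deriv ?_⟩
  rw [sq (deriv a t)]

lemma tendsto_deriv_hubble_div (hs : ContDiffOn ℝ ∞ a (Iio tmax))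
    (ha2 : (fun t => deriv (deriv a) t -
        (h ^ 2 * Real.exp (h * t) + 9 * h ^ 2 * b * Real.exp (3 * h * t)))
      =o[atBot] fun t => Real.exp (3 * h * t)) :
    Tendsto (fun t => deriv (hubble a) t / a t ^ 2) atBot (𝓝 (4 * b * h ^ 2)) := by
  obtain ⟨ε₀, hε₀, he₀⟩ := exists_remainder ha0
  obtain ⟨ε₁, hε₁, he₁⟩ := exists_remainder ha1
  obtain ⟨ε₂, hε₂, he₂⟩ := exists_remainder ha2
  have hx := (tendsto_exp_mul_atBot hh).pow 2
  -- In ä a - ȧ² the x² terms cancel. What is left, divided by x⁴, is this expression, with limit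
  -- h²b + 9h²b - 6h²b = 4bh²; the denominator a⁴/x⁴ tends to 1.
  have hnum := ((((hε₀.const_add b).const_mul (h ^ 2)).add (hε₂.const_add (9 * h ^ 2 * b))).sub
    ((hε₁.const_add (3 * h * b)).const_mul (2 * h))).add
    ((((hε₀.const_add b).mul (hε₂.const_add (9 * h ^ 2 * b))).sub
      ((hε₁.const_add (3 * h * b)).pow 2)).mul hx)
  have hlim := hnum.div ((tendsto_div_exp hh ha0).pow 4) (by norm_num)
  have hval : (h ^ 2 * (b + 0) + (9 * h ^ 2 * b + 0) - 2 * h * (3 * h * b + 0) +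
      ((b + 0) * (9 * h ^ 2 * b + 0) - (3 * h * b + 0) ^ 2) * 0 ^ 2) / 1 ^ 4 =
      4 * b * h ^ 2 := by ring
  rw [hval] at hlim
  refine hlim.congr' ?_
  filter_upwards [eventually_lt_atBot tmax] with t ht
  have h2 := hpos t ht
  have h3 := Real.exp_pos (h * t)
  simp only [Pi.div_apply]
  rw [(hasDerivAt_hubble hpos hs ht).2.2.deriv, he₂ t, he₁ t]
  field_simp
  rw [he₀ t]
  ring

end Limits

/-! ### Regularity of pulled back bilinear forms -/

section Pullback

variable {E : Type*} [NormedAddCommGroup E] [NormedSpace ℝ E]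
  {Hm : Type*} [TopologicalSpace Hm] {I : ModelWithCorners ℝ E Hm}
  {N : Type*} [TopologicalSpace N] [ChartedSpace Hm N] [IsManifold I ∞ N]
  {F : Type*} [NormedAddCommGroup F] [NormedSpace ℝ F]


/-- The pullback under `f` of a family of bilinear forms on a vector space. -/
noncomputable def pullbackForm (I : ModelWithCorners ℝ E Hm) (f : N → F) (B : N → F →L[ℝ] F →L[ℝ] ℝ)
    (p : N) : TangentSpace I p →L[ℝ] TangentSpace I p →L[ℝ] ℝ :=
  (ContinuousLinearMap.precomp ℝ (mvfderiv I f p)).comp ((B p).comp (mvfderiv I f p))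

omit [IsManifold I ∞ N] in
lemma pullbackForm_apply (f : N → F) (B : N → F →L[ℝ] F →L[ℝ] ℝ) (p : N) (X Y : TangentSpace I p) :
    pullbackForm I f B p X Y = B p (mvfderiv I f p X) (mvfderiv I f p Y) := rfl

/-- In the tangent trivialization at a point the pullback reads (v, w) ↦ B(Dv, Dw), with D the
coordinate derivative of `f`. Smoothness of `f` absorbs the derivative lost in D. -/
lemma contMDiffOn_pullbackForm {k : ℕ∞} {f : N → F} {B : N → F →L[ℝ] F →L[ℝ] ℝ} {V : Set N}
    (hf : ContMDiff I 𝓘(ℝ, F) ∞ f) (hB : ContMDiffOn I 𝓘(ℝ, F →L[ℝ] F →L[ℝ] ℝ) k B V) :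
    ContMDiffOn I (I.prod 𝓘(ℝ, E →L[ℝ] E →L[ℝ] ℝ)) k
    (fun p : N => TotalSpace.mk' (E →L[ℝ] E →L[ℝ] ℝ)
      (E := fun p : N => TangentSpace I p →L[ℝ] TangentSpace I p →L[ℝ] ℝ) p
      (pullbackForm I f B p)) V := by
  intro p hp
  have : IsManifold I 1 N := IsManifold.of_le (n := ∞) (by simp)
  rw [contMDiffWithinAt_hom_bundle]
  refine ⟨contMDiffWithinAt_id, ?_⟩
  have hD : ContMDiffWithinAt I 𝓘(ℝ, E →L[ℝ] F) k
      (inTangentCoordinates I 𝓘(ℝ, F) id f (mfderiv I 𝓘(ℝ, F) f) p) V p :=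
    (ContMDiffAt.mfderiv_const (m := k) (n := ∞) hf.contMDiffAt
      (by exact_mod_cast le_top)).contMDiffWithinAt
  have hc := (hD.clm_precomp (F₃ := ℝ)).clm_comp ((hB p hp).clm_comp hD)
  have key : ∀ q ∈ (trivializationAt E (TangentSpace I) p).baseSet,
      ContinuousLinearMap.inCoordinates E (TangentSpace I) (E →L[ℝ] ℝ)
        (fun x => TangentSpace I x →L[ℝ] ℝ) p q p q (pullbackForm I f B q) =
      (ContinuousLinearMap.precomp ℝ
        (inTangentCoordinates I 𝓘(ℝ, F) id f (mfderiv I 𝓘(ℝ, F) f) p q)).comp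
        ((B q).comp (inTangentCoordinates I 𝓘(ℝ, F) id f (mfderiv I 𝓘(ℝ, F) f) p q)) := by
    intro q hq
    have hD' : ∀ v : E, inTangentCoordinates I 𝓘(ℝ, F) id f (mfderiv I 𝓘(ℝ, F) f) p q v =
        mvfderiv I f q ((trivializationAt E (TangentSpace I) p).symm q v) := by
      intro v
      change ContinuousLinearMap.inCoordinates E (TangentSpace I) F (TangentSpace 𝓘(ℝ, F))
        p q (f p) (f q) (mfderiv I 𝓘(ℝ, F) f q) v = _
      rw [ContinuousLinearMap.inCoordinates_eq hq
        (by rw [TangentBundle.trivializationAt_baseSet, chartAt_self_eq]; trivial)]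
      simp
      rfl
    ext v w
    rw [inCoordinates_apply_eq₂ hq hq (by simp)]
    simp [hD', pullbackForm_apply]
  refine hc.congr_of_eventuallyEq ?_ (key p (mem_baseSet_trivializationAt _ _ _))
  refine mem_nhdsWithin_of_mem_nhds ?_
  filter_upwards [(trivializationAt E (TangentSpace I) p).open_baseSet.mem_nhds
    (mem_baseSet_trivializationAt _ _ _)] with q hq using key q hq

end Pullback
-- The null form on ℝ × ℝ × 𝕊²: Lorentzian bases and a timelike field
section Cylinder

lemma hasMFDerivAt_prodMk_space {E : Type*} [NormedAddCommGroup E] [NormedSpace ℝ E]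
    {Hm : Type*} [TopologicalSpace Hm] {I : ModelWithCorners ℝ E Hm}
    {N : Type*} [TopologicalSpace N] [ChartedSpace Hm N]
    {F : Type*} [NormedAddCommGroup F] [NormedSpace ℝ F]
    {F' : Type*} [NormedAddCommGroup F'] [NormedSpace ℝ F']
    {f : N → F} {g : N → F'} {x : N} {df dg} (hf : HasMFDerivAt I 𝓘(ℝ, F) f x df)
    (hg : HasMFDerivAt I 𝓘(ℝ, F') g x dg) :
    HasMFDerivAt I 𝓘(ℝ, F × F') (fun x => (f x, g x)) x (df.prod dg) := by
  rw [modelWithCornersSelf_prod, ← chartedSpaceSelf_prod]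
  exact hf.prodMk hg

instance fact_finrank_E3 : Fact (Module.finrank ℝ E3 = 2 + 1) := ⟨by simp⟩

/-- The inclusion of the cylinder `ℝ × ℝ × 𝕊²` in a vector space. -/
def incl (p : Cyl) : ℝ × ℝ × E3 := (p.1, p.2.1, (p.2.2 : E3))

/-- The derivative of the inclusion of the two-sphere in Euclidean space. -/
noncomputable def sphereTangent (u : S2) : TangentSpace (𝓡 2) u →L[ℝ] E3 :=
  mvfderiv (𝓡 2) ((↑) : S2 → E3) u

lemma contMDiff_incl : ContMDiff ICyl 𝓘(ℝ, ℝ × ℝ × E3) ∞ incl := by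
  have h3 : ContMDiff ICyl 𝓘(ℝ, E3) ∞ fun p : Cyl => (p.2.2 : E3) :=
    contMDiff_coe_sphere.comp (contMDiff_snd.comp contMDiff_snd)
  have h2 : ContMDiff ICyl 𝓘(ℝ, ℝ) ∞ fun p : Cyl => p.2.1 := contMDiff_fst.comp contMDiff_snd
  exact contMDiff_fst.prodMk_space (h2.prodMk_space h3)

lemma mvfderiv_incl (p : Cyl) (X : TangentSpace ICyl p) :
    mvfderiv ICyl incl p X = (X.1, X.2.1, sphereTangent p.2.2 X.2.2) := by
  have hS : HasMFDerivAt (𝓡 2) 𝓘(ℝ, E3) ((↑) : S2 → E3) p.2.2 _ :=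
    ((contMDiff_coe_sphere (m := ∞) p.2.2).mdifferentiableAt (by simp)).hasMFDerivAt
  have hsnd := hasMFDerivAt_snd (I := 𝓘(ℝ, ℝ)) (I' := (𝓘(ℝ, ℝ)).prod (𝓡 2)) p
  have h3 : HasMFDerivAt ICyl 𝓘(ℝ, E3) (fun p : Cyl => (p.2.2 : E3)) p _ :=
    hS.comp p ((hasMFDerivAt_snd (I := 𝓘(ℝ, ℝ)) (I' := 𝓡 2) p.2).comp p hsnd)
  have h2 : HasMFDerivAt ICyl 𝓘(ℝ, ℝ) (fun p : Cyl => p.2.1) p _ :=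
    (hasMFDerivAt_fst (I := 𝓘(ℝ, ℝ)) (I' := 𝓡 2) p.2).comp p hsnd
  have h1 := hasMFDerivAt_fst (I := 𝓘(ℝ, ℝ)) (I' := (𝓘(ℝ, ℝ)).prod (𝓡 2)) p
  have := (hasMFDerivAt_prodMk_space h1 (hasMFDerivAt_prodMk_space h2 h3)).mfderiv
  change (mfderiv ICyl 𝓘(ℝ, ℝ × ℝ × E3) (fun p : Cyl => (p.1, p.2.1, (p.2.2 : E3))) p) X = _
  rw [this]
  rfl

lemma range_sphereTangent (u : S2) : (sphereTangent u).range = (ℝ ∙ (u : E3))ᗮ :=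
  range_mvfderiv_subtypeVal u

lemma inner_sphereTangent (u : S2) (X : TangentSpace (𝓡 2) u) :
    inner ℝ (u : E3) (sphereTangent u X) = 0 := by
  have : sphereTangent u X ∈ (ℝ ∙ (u : E3))ᗮ := by
    rw [← range_sphereTangent]
    exact LinearMap.mem_range_self _ X
  exact Submodule.mem_orthogonal_singleton_iff_inner_right.1 this

/-- The derivative of the inclusion has range u^⊥, so an orthonormal basis of u^⊥ lifts. -/
lemma exists_orthonormal_sphereTangent (u : S2) :
    ∃ w : Fin 2 → TangentSpace (𝓡 2) u, ∀ i j,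
      inner ℝ (sphereTangent u (w i)) (sphereTangent u (w j)) = if i = j then 1 else 0 := by
  let b := OrthonormalBasis.fromOrthogonalSpanSingleton (𝕜 := ℝ) 2
    (ne_zero_of_mem_unit_sphere u)
  have hb : ∀ i, ∃ w, sphereTangent u w = b i := fun i => by
    have h1 : (b i : E3) ∈ (sphereTangent u).range := by
      rw [range_sphereTangent]
      exact (b i).2
    exact h1
  choose w hw using hb
  refine ⟨w, fun i j => ?_⟩
  rw [hw, hw, ← Submodule.coe_inner]
  exact orthonormal_iff_ite.1 b.orthonormal i j

/-- The bilinear form `c dv² - 2 dl dv + d |dx|²` on `ℝ × ℝ × ℝ³` with coordinates `(l, v, x)`. -/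
noncomputable def nullForm (c d : ℝ) : (ℝ × ℝ × E3) →L[ℝ] (ℝ × ℝ × E3) →L[ℝ] ℝ :=
  let ip : E3 →L[ℝ] E3 →L[ℝ] ℝ := innerSL ℝ
  let l := ContinuousLinearMap.fst ℝ ℝ (ℝ × E3)
  let v := (ContinuousLinearMap.fst ℝ ℝ E3).comp (ContinuousLinearMap.snd ℝ ℝ (ℝ × E3))
  let x := (ContinuousLinearMap.snd ℝ ℝ E3).comp (ContinuousLinearMap.snd ℝ ℝ (ℝ × E3))
  c • (ContinuousLinearMap.mul ℝ ℝ).bilinearComp v v -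
    ((ContinuousLinearMap.mul ℝ ℝ).bilinearComp l v +
      (ContinuousLinearMap.mul ℝ ℝ).bilinearComp v l) + d • ip.bilinearComp x x

lemma nullForm_apply (c d : ℝ) (X Y : ℝ × ℝ × E3) :
    nullForm c d X Y = c * (X.2.1 * Y.2.1) - (X.1 * Y.2.1 + X.2.1 * Y.1) +
      d * inner ℝ X.2.2 Y.2.2 := by
  simp [nullForm]
  exact Or.inl rfl

lemma contMDiffOn_smul_sub_add_smul {E : Type*} [NormedAddCommGroup E] [NormedSpace ℝ E]
    {Hm : Type*} [TopologicalSpace Hm] {I : ModelWithCorners ℝ E Hm}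
    {N : Type*} [TopologicalSpace N] [ChartedSpace Hm N] {k : ℕ∞} {c d : N → ℝ} {V : Set N}
    {W : Type*} [NormedAddCommGroup W] [NormedSpace ℝ W] (B₁ B₂ B₃ : W)
    (hc : ContMDiffOn I 𝓘(ℝ, ℝ) k c V) (hd : ContMDiffOn I 𝓘(ℝ, ℝ) k d V) :
    ContMDiffOn I 𝓘(ℝ, W) k (fun p => c p • B₁ - B₂ + d p • B₃) V := by
  have h : ContDiff ℝ k fun x : ℝ × ℝ => x.1 • B₁ - B₂ + x.2 • B₃ := by fun_prop
  exact h.contMDiff.comp_contMDiffOn (hc.prodMk_space hd)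

lemma contMDiffOn_nullForm {E : Type*} [NormedAddCommGroup E] [NormedSpace ℝ E]
    {Hm : Type*} [TopologicalSpace Hm] {I : ModelWithCorners ℝ E Hm}
    {N : Type*} [TopologicalSpace N] [ChartedSpace Hm N] {k : ℕ∞} {c d : N → ℝ} {V : Set N}
    (hc : ContMDiffOn I 𝓘(ℝ, ℝ) k c V) (hd : ContMDiffOn I 𝓘(ℝ, ℝ) k d V) :
    ContMDiffOn I 𝓘(ℝ, (ℝ × ℝ × E3) →L[ℝ] (ℝ × ℝ × E3) →L[ℝ] ℝ) k
      (fun p => nullForm (c p) (d p)) V :=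
  contMDiffOn_smul_sub_add_smul _ _ _ hc hd

/-- Pairing a linear relation with `e j` isolates ± its `j`-th coefficient, so a pseudo-orthonormal
family is independent, and four vectors suffice by dimension. -/
lemma exists_lorentzian_basis {M : Type*} [AddCommGroup M] [Module ℝ M]
    (hM : Module.finrank ℝ M = 4) (g : M →ₗ[ℝ] M →ₗ[ℝ] ℝ) (e : Fin 4 → M)
    (he : ∀ i j, g (e i) (e j) = if i = j then (if i = 0 then -1 else 1) else 0) :
    ∃ e : Module.Basis (Fin 4) ℝ M, ∀ i j : Fin 4,
      g (e i) (e j) = if i = j then (if i = 0 then -1 else 1) else 0 := by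
  have hli : LinearIndependent ℝ e := by
    rw [Fintype.linearIndependent_iff]
    intro c hc j
    have h1 := congrArg (fun x => g x (e j)) hc
    simp only [map_sum, map_smul, LinearMap.sum_apply, LinearMap.smul_apply, he, smul_eq_mul,
      mul_ite, mul_zero, Finset.sum_ite_eq', Finset.mem_univ, if_true, map_zero,
      LinearMap.zero_apply] at h1
    split_ifs at h1 <;> linarith
  refine ⟨basisOfLinearIndependentOfCardEqFinrank hli (by simp [hM]), fun i j => ?_⟩
  simpa using he i j

lemma lorentzian_pullback_nullForm (c : ℝ) {d : ℝ} (hd : 0 < d) (p : Cyl)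
    (g : TangentSpace ICyl p →L[ℝ] TangentSpace ICyl p →L[ℝ] ℝ)
    (hg : ∀ X Y, g X Y = nullForm c (d ^ 2) (mvfderiv ICyl incl p X) (mvfderiv ICyl incl p Y)) :
    ∃ e : Module.Basis (Fin 4) ℝ (TangentSpace ICyl p), ∀ i j : Fin 4,
      g (e i) (e j) = if i = j then (if i = 0 then -1 else 1) else 0 := by
  obtain ⟨w, hw⟩ := exists_orthonormal_sphereTangent p.2.2
  have hfr : Module.finrank ℝ (TangentSpace ICyl p) = 4 := by
    change Module.finrank ℝ (ℝ × ℝ × EuclideanSpace ℝ (Fin 2)) = 4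
    simp
  let G : TangentSpace ICyl p →ₗ[ℝ] TangentSpace ICyl p →ₗ[ℝ] ℝ :=
    (ContinuousLinearMap.coeLM ℝ).comp g.toLinearMap
  -- A vector (s, 1, 0) has square c - 2s, so s = (c ± 1)/2 gives squares ∓1; the mutual product is
  -- c - (c + 1)/2 - (c - 1)/2 = 0. This works for every `c`, including `c = 0`.
  let e : Fin 4 → TangentSpace ICyl p :=
    ![(((c + 1) / 2, 1, 0) : ℝ × ℝ × TangentSpace (𝓡 2) p.2.2),
      (((c - 1) / 2, 1, 0) : ℝ × ℝ × TangentSpace (𝓡 2) p.2.2),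
      ((0, 0, d⁻¹ • w 0) : ℝ × ℝ × TangentSpace (𝓡 2) p.2.2),
      ((0, 0, d⁻¹ • w 1) : ℝ × ℝ × TangentSpace (𝓡 2) p.2.2)]
  let ε : Fin 4 → ℝ × ℝ × E3 := ![((c + 1) / 2, 1, 0), ((c - 1) / 2, 1, 0),
      (0, 0, d⁻¹ • sphereTangent p.2.2 (w 0)), (0, 0, d⁻¹ • sphereTangent p.2.2 (w 1))]
  have hε : ∀ i, mvfderiv ICyl incl p (e i) = ε i := by
    intro i
    rw [mvfderiv_incl]
    fin_cases i
    · exact congrArg (fun x : E3 => ((c + 1) / 2, (1 : ℝ), x)) (map_zero _)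
    · exact congrArg (fun x : E3 => ((c - 1) / 2, (1 : ℝ), x)) (map_zero _)
    · exact congrArg (fun x : E3 => ((0 : ℝ), (0 : ℝ), x)) (map_smul _ _ _)
    · exact congrArg (fun x : E3 => ((0 : ℝ), (0 : ℝ), x)) (map_smul _ _ _)
  refine exists_lorentzian_basis hfr G e fun i j => ?_
  change g (e i) (e j) = _
  rw [hg, hε, hε, nullForm_apply]
  have hd' := hd.ne'
  have hn : ∀ i, ‖sphereTangent p.2.2 (w i)‖ = 1 := fun i => by
    have h1 := hw i i
    rw [real_inner_self_eq_norm_sq, if_pos rfl] at h1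
    exact (pow_eq_one_iff_of_nonneg (norm_nonneg _) two_ne_zero).1 h1
  fin_cases i <;> fin_cases j <;>
    simp [ε, inner_smul_left, inner_smul_right, hw, norm_smul, hn] <;> field_simp <;> ring

/-- The vector field `((c + 1) / 2) ∂_l + ∂_v` on `ℝ × ℝ × 𝕊²`. -/
noncomputable def nullField (c : ℝ → ℝ) (p : Cyl) : TangentSpace ICyl p :=
  (((c p.1 + 1) / 2, 1, 0) : ℝ × ℝ × TangentSpace (𝓡 2) p.2.2)

lemma mvfderiv_incl_nullField (c : ℝ → ℝ) (p : Cyl) :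
    mvfderiv ICyl incl p (nullField c p) = ((c p.1 + 1) / 2, 1, 0) := by
  rw [mvfderiv_incl]
  exact congrArg (fun x : E3 => ((c p.1 + 1) / 2, (1 : ℝ), x)) (map_zero _)

lemma continuous_nullField {c : ℝ → ℝ} (hc : Continuous c) :
    Continuous (fun p : Cyl => TotalSpace.mk' (ℝ × ℝ × EuclideanSpace ℝ (Fin 2))
    (E := fun p : Cyl => TangentSpace ICyl p) p (nullField c p)) := by
  have hvec : ∀ {f : ℝ → ℝ}, Continuous f →
      Continuous fun x : ℝ => (⟨x, f x⟩ : TangentBundle 𝓘(ℝ, ℝ) ℝ) := by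
    intro f hf
    exact (contMDiff_vectorSpace_iff_contDiff (n := 0) (V := fun x : ℝ =>
      (f x : TangentSpace 𝓘(ℝ, ℝ) x))).2 (contDiff_zero.2 hf) |>.continuous
  have hz : Continuous fun u : S2 => (⟨u, 0⟩ : TangentBundle (𝓡 2) S2) :=
    (contMDiff_zeroSection (IB := 𝓡 2) (n := 0) ℝ (TangentSpace (𝓡 2) (M := S2))).continuous
  -- Continuity is checked factor by factor through the identification of the tangent bundle of a
  -- product with the product of tangent bundles.
  have e1 := (contMDiff_equivTangentBundleProd_symm (n := 0) (I := 𝓘(ℝ, ℝ)) (I' := 𝓡 2)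
    (M := ℝ) (M' := S2)).continuous
  have e2 := (contMDiff_equivTangentBundleProd_symm (n := 0) (I := 𝓘(ℝ, ℝ))
    (I' := (𝓘(ℝ, ℝ)).prod (𝓡 2)) (M := ℝ) (M' := ℝ × S2)).continuous
  have h1 := (hvec (f := fun x => (c x + 1) / 2) (by fun_prop)).comp
    (continuous_fst (X := ℝ) (Y := ℝ × S2))
  have h2 := (hvec (f := fun _ => 1) continuous_const).comp
    ((continuous_fst (X := ℝ) (Y := S2)).comp (continuous_snd (X := ℝ)))
  have h3 := hz.comp ((continuous_snd (X := ℝ) (Y := S2)).comp (continuous_snd (X := ℝ)))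
  exact e2.comp (h1.prodMk (e1.comp (h2.prodMk h3)))

end Cylinder

/-! ### The change of coordinates and the FLRW metric -/

section Coordinates

lemma mfderiv_toLamV {a : ℝ → ℝ} {tL α η' : ℝ} {q : Cyl} (hl : HasDerivAt (lam a) α q.1)
    (hη : HasDerivAt (conformalTime a tL) η' q.1) (X : TangentSpace ICyl q) :
    mfderiv ICyl ICyl (toLamV a tL) q X =
      ((α * X.1, η' * X.1 + X.2.1, X.2.2) : ℝ × ℝ × TangentSpace (𝓡 2) q.2.2) := by
  have hsnd := hasMFDerivAt_snd (I := 𝓘(ℝ, ℝ)) (I' := (𝓘(ℝ, ℝ)).prod (𝓡 2)) q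
  have h3 : HasMFDerivAt ICyl (𝓡 2) (fun p : Cyl => p.2.2) q _ :=
    (hasMFDerivAt_snd (I := 𝓘(ℝ, ℝ)) (I' := 𝓡 2) q.2).comp q hsnd
  have h2 : HasMFDerivAt ICyl 𝓘(ℝ, ℝ) (fun p : Cyl => p.2.1) q _ :=
    (hasMFDerivAt_fst (I := 𝓘(ℝ, ℝ)) (I' := 𝓡 2) q.2).comp q hsnd
  have h1 := hasMFDerivAt_fst (I := 𝓘(ℝ, ℝ)) (I' := (𝓘(ℝ, ℝ)).prod (𝓡 2)) q
  have hl' : HasMFDerivAt ICyl 𝓘(ℝ, ℝ) (fun p : Cyl => lam a p.1) q _ :=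
    (HasFDerivAt.hasMFDerivAt hl.hasFDerivAt).comp q h1
  have hη' : HasMFDerivAt ICyl 𝓘(ℝ, ℝ) (fun p : Cyl => conformalTime a tL p.1) q _ :=
    (HasFDerivAt.hasMFDerivAt hη.hasFDerivAt).comp q h1
  have := (hl'.prodMk ((hη'.add h2).prodMk h3)).mfderiv
  change (mfderiv ICyl ICyl
    (fun q : Cyl => ((lam a q.1, conformalTime a tL q.1 + q.2.1, q.2.2) : Cyl)) q) X = _
  have e : ∀ Y : TangentSpace ICyl q, mfderiv ICyl ICyl
      (fun q : Cyl => ((lam a q.1, conformalTime a tL q.1 + q.2.1, q.2.2) : Cyl)) q Y =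
      ((Y.1 * α, Y.1 * η' + Y.2.1, Y.2.2) : ℝ × ℝ × TangentSpace (𝓡 2) q.2.2) := by
    intro Y
    exact congrArg (fun L => L Y) this
  rw [e, mul_comm α, mul_comm η']

lemma mvfderiv_incl_mfderiv_toLamV {a : ℝ → ℝ} {tL α η' : ℝ} {q : Cyl}
    (hl : HasDerivAt (lam a) α q.1) (hη : HasDerivAt (conformalTime a tL) η' q.1)
    (X : TangentSpace ICyl q) :
    mvfderiv ICyl incl (toLamV a tL q) (mfderiv ICyl ICyl (toLamV a tL) q X) =
      (α * X.1, η' * X.1 + X.2.1, sphereTangent q.2.2 X.2.2) := by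
  rw [mvfderiv_incl, mfderiv_toLamV hl hη]
  rfl

lemma mfderiv_polar (q : Cyl) (X : TangentSpace ICyl q) :
    mfderiv ICyl 𝓘(ℝ, ℝ × E3) polar q X =
      ((X.1, q.2.1 • sphereTangent q.2.2 X.2.2 + X.2.1 • (q.2.2 : E3)) : ℝ × E3) := by
  have hi : HasMFDerivAt ICyl 𝓘(ℝ, ℝ × ℝ × E3) incl q _ :=
    ((contMDiff_incl q).mdifferentiableAt (by simp)).hasMFDerivAt
  have hr : HasFDerivAt (fun y : ℝ × ℝ × E3 => y.2.1) _ (incl q) :=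
    ((ContinuousLinearMap.fst ℝ ℝ E3).comp (ContinuousLinearMap.snd ℝ ℝ (ℝ × E3))).hasFDerivAt
  have hx : HasFDerivAt (fun y : ℝ × ℝ × E3 => y.2.2) _ (incl q) :=
    ((ContinuousLinearMap.snd ℝ ℝ E3).comp (ContinuousLinearMap.snd ℝ ℝ (ℝ × E3))).hasFDerivAt
  have hP : HasFDerivAt (fun y : ℝ × ℝ × E3 => (y.1, y.2.1 • y.2.2)) _ (incl q) :=
    hasFDerivAt_fst.prodMk (hr.fun_smul hx)
  have := ((HasFDerivAt.hasMFDerivAt hP).comp q hi).mfderiv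
  have hX : (mfderiv ICyl 𝓘(ℝ, ℝ × ℝ × E3) incl q X : ℝ × ℝ × E3) =
    (X.1, X.2.1, sphereTangent q.2.2 X.2.2) := mvfderiv_incl q X
  change mfderiv ICyl 𝓘(ℝ, ℝ × E3) ((fun y : ℝ × ℝ × E3 => (y.1, y.2.1 • y.2.2)) ∘ incl) q X = _
  rw [this]
  change ((mfderiv ICyl 𝓘(ℝ, ℝ × ℝ × E3) incl q X : ℝ × ℝ × E3).1,
    q.2.1 • (mfderiv ICyl 𝓘(ℝ, ℝ × ℝ × E3) incl q X : ℝ × ℝ × E3).2.2 +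
      (mfderiv ICyl 𝓘(ℝ, ℝ × ℝ × E3) incl q X : ℝ × ℝ × E3).2.1 • (q.2.2 : E3)) = _
  rw [hX]

/-- In the coordinates `(lam, v, u)` the FLRW metric is `a² dv² - 2 dlam dv + (a r)² dΩ²`. -/
lemma nullForm_eq_flrwMetric {a : ℝ → ℝ} {tL : ℝ} {q : Cyl} (ha : a q.1 ≠ 0)
    (hl : HasDerivAt (lam a) (a q.1) q.1) (hη : HasDerivAt (conformalTime a tL) (1 / a q.1) q.1)
    (X Y : TangentSpace ICyl q) :
    nullForm (a q.1 ^ 2) ((a q.1 * q.2.1) ^ 2)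
      (mvfderiv ICyl incl (toLamV a tL q) (mfderiv ICyl ICyl (toLamV a tL) q X))
      (mvfderiv ICyl incl (toLamV a tL q) (mfderiv ICyl ICyl (toLamV a tL) q Y)) =
    flrwMetric a (polar q) (mfderiv ICyl 𝓘(ℝ, ℝ × E3) polar q X)
      (mfderiv ICyl 𝓘(ℝ, ℝ × E3) polar q Y) := by
  rw [mvfderiv_incl_mfderiv_toLamV hl hη, mvfderiv_incl_mfderiv_toLamV hl hη, mfderiv_polar,
    mfderiv_polar, nullForm_apply, flrwMetric]
  -- Radial and spherical directions are orthogonal and u is a unit vector. There remains a² dv² - 2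
  -- dλ dv = -dt² + a² dr², from dλ = a dt and dv = dt/a + dr.
  have hu : inner ℝ (q.2.2 : E3) (q.2.2 : E3) = (1 : ℝ) := by
    rw [real_inner_self_eq_norm_sq, norm_eq_of_mem_sphere, one_pow]
  have hX := inner_sphereTangent q.2.2 X.2.2
  have hY := inner_sphereTangent q.2.2 Y.2.2
  have hX' := (real_inner_comm _ _).trans hX
  simp only [polar, inner_add_left, inner_add_right, real_inner_smul_left, real_inner_smul_right,
    hu, hX', hY]
  field_simp
  ring

end Coordinates

/-! ### Construction of the extension -/

section Main

lemma locallyConnectedSpace_cyl : LocallyConnectedSpace Cyl := by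
  have : LocallyConnectedSpace (ModelProd ℝ (ModelProd ℝ (EuclideanSpace ℝ (Fin 2)))) :=
    inferInstanceAs (LocallyConnectedSpace (ℝ × ℝ × EuclideanSpace ℝ (Fin 2)))
  exact ChartedSpace.locallyConnectedSpace (ModelProd ℝ (ModelProd ℝ (EuclideanSpace ℝ (Fin 2)))) _

/-- An open set containing the hypersurface `{0} × ℝ × 𝕊²` contains a connected open one. -/
lemma exists_connected_open_subset {W : Set Cyl} (hW : IsOpen W)
    (h0 : ∀ (v : ℝ) (u : S2), ((0, v, u) : Cyl) ∈ W) :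
    ∃ V ⊆ W, IsOpen V ∧ IsConnected V ∧ ∀ (v : ℝ) (u : S2), ((0, v, u) : Cyl) ∈ V := by
  have := locallyConnectedSpace_cyl
  have hS : IsConnected (Metric.sphere (0 : E3) 1) :=
    isConnected_sphere (by rw [← Module.finrank_eq_rank]; simp) _ zero_le_one
  have : ConnectedSpace S2 := isConnected_iff_connectedSpace.1 hS
  have hZ : IsConnected (({0} : Set ℝ) ×ˢ (univ : Set (ℝ × S2))) :=
    isConnected_singleton.prod isConnected_univ
  obtain ⟨u₀⟩ : Nonempty S2 := inferInstance
  have hp : ((0, 0, u₀) : Cyl) ∈ ({0} : Set ℝ) ×ˢ (univ : Set (ℝ × S2)) := by simp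
  -- The hypersurface is connected, so one component of `W` contains all of it; that component is
  -- open by local connectedness.
  refine ⟨connectedComponentIn W (0, 0, u₀), connectedComponentIn_subset _ _,
    hW.connectedComponentIn, isConnected_connectedComponentIn_iff.2 (h0 _ _), fun v u => ?_⟩
  refine hZ.isPreconnected.subset_connectedComponentIn hp ?_ (by simp)
  rintro ⟨x, v, u⟩ ⟨hx, -⟩
  obtain rfl : x = 0 := hx
  exact h0 v u

/-- If `a` and `a η` are the restrictions of `C^k` functions `A` and `G` of the coordinate `lam`,
with `A 0 = 0` and `G 0 < 0`, then the spacetime has a `C^k` extension through `lam = 0`. -/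
lemma admitsExtension_of_contDiff {a : ℝ → ℝ} {tmax tL t₁ : ℝ} {k : ℕ∞} {A G : ℝ → ℝ}
    (ha : ∀ t < tmax, 0 < a t) (hl : ∀ t < tmax, HasDerivAt (lam a) (a t) t)
    (hlim : Tendsto (lam a) atBot (𝓝 0))
    (hη : ∀ t < tmax, HasDerivAt (conformalTime a tL) (1 / a t) t) (ht₁ : t₁ < tmax)
    (hA : ContDiff ℝ k A) (hG : ContDiff ℝ k G) (hAa : ∀ t < t₁, A (lam a t) = a t)
    (hGa : ∀ t < t₁, G (lam a t) = a t * conformalTime a tL t) (hA0 : A 0 = 0) (hG0 : G 0 < 0) :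
    AdmitsExtensionThroughLamZero a tmax tL k := by
  have hmono := strictMonoOn_of_hasDerivAt hl ha
  have hpos : ∀ t < tmax, 0 < lam a t := fun t ht => pos_of_tendsto_atBot hl ha hlim ht
  -- `R` extends the area radius a r = a v - a η; on λ = 0 it equals -`G 0` > 0.
  set R : Cyl → ℝ := fun p => A p.1 * p.2.1 - G p.1 with hR
  have hRc : Continuous R := by
    have := hA.continuous
    have := hG.continuous
    fun_prop
  obtain ⟨V, hVW, hVo, hVc, hV0⟩ := exists_connected_open_subset
    (W := {p | p.1 < lam a t₁ ∧ 0 < R p})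
    ((isOpen_lt continuous_fst continuous_const).inter (isOpen_lt continuous_const hRc))
    (fun v u => ⟨hpos t₁ ht₁, by simp [hR, hA0, hG0]⟩)
  have ht : ∀ q ∈ sphDomain tmax, toLamV a tL q ∈ V → q.1 < t₁ := fun q hq hqV =>
    (hmono.lt_iff_lt hq.1 ht₁).1 (hVW hqV).1
  have hRq : ∀ q : Cyl, q.1 < t₁ → R (toLamV a tL q) = a q.1 * q.2.1 := by
    intro q hq
    simp only [hR, toLamV]
    rw [hAa _ hq, hGa _ hq]
    ring
  have hfst : ContMDiff ICyl 𝓘(ℝ, ℝ) k fun p : Cyl => p.1 := contMDiff_fst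
  have hv : ContMDiff ICyl 𝓘(ℝ, ℝ) k fun p : Cyl => p.2.1 := contMDiff_fst.comp contMDiff_snd
  have hA' : ContMDiff ICyl 𝓘(ℝ, ℝ) k fun p : Cyl => A p.1 := hA.contMDiff.comp hfst
  have hR' : ContMDiff ICyl 𝓘(ℝ, ℝ) k R := (hA'.mul hv).sub (hG.contMDiff.comp hfst)
  have hsq : ∀ {f : Cyl → ℝ}, ContMDiff ICyl 𝓘(ℝ, ℝ) k f →
      ContMDiff ICyl 𝓘(ℝ, ℝ) k fun p => f p ^ 2 := fun hf =>
    ((contDiff_id (𝕜 := ℝ) (E := ℝ)).pow 2).contMDiff.comp hf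
  refine ⟨V, pullbackForm ICyl incl fun p => nullForm (A p.1 ^ 2) (R p ^ 2),
    nullField fun x => A x ^ 2, hVo, hVc, hV0, ?_, ⟨?_, ?_⟩, ⟨?_, ?_⟩, ?_, ?_⟩
  · rintro ⟨x, v, u⟩ hp hx
    obtain ⟨s, hs, rfl⟩ := exists_eq_of_lt hl hlim ht₁ hx (hVW hp).1
    have hs' := hs.trans ht₁
    have heq : toLamV a tL (s, v - conformalTime a tL s, u) = (lam a s, v, u) := by
      simp [toLamV]
    refine ⟨(s, v - conformalTime a tL s, u), ⟨hs', ?_⟩, heq⟩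
    -- Here `R` = a r and a > 0, so `R > 0` forces r > 0.
    have h1 := (hVW hp).2
    rw [← heq, hRq _ hs] at h1
    exact pos_of_mul_pos_right h1 (ha s hs').le
  · exact contMDiffOn_pullbackForm contMDiff_incl
      (contMDiffOn_nullForm (hsq hA').contMDiffOn (hsq hR').contMDiffOn)
  · intro p hp
    exact lorentzian_pullback_nullForm _ (hVW hp).2 p _ fun X Y => pullbackForm_apply _ _ _ _ _
  · have := hA.continuous
    exact (continuous_nullField (by fun_prop)).continuousOn
  · intro p _
    rw [pullbackForm_apply, mvfderiv_incl_nullField, nullForm_apply]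
    simp
  · intro q hq hqV X Y
    have hqt := ht q hq hqV
    rw [pullbackForm_apply, hRq q hqt, show A (toLamV a tL q).1 = a q.1 from hAa _ hqt]
    exact nullForm_eq_flrwMetric (ha _ hq.1).ne' (hl _ hq.1) (hη _ hq.1) X Y
  · intro q hq hqV
    have hqt := ht q hq hqV
    have hap := ha _ hq.1
    rw [pullbackForm_apply, mvfderiv_incl_nullField]
    refine lt_of_eq_of_lt (congrArg (nullForm _ _ _)
      (mvfderiv_incl_mfderiv_toLamV (hl _ hq.1) (hη _ hq.1) _)) ?_
    rw [nullForm_apply, show A (toLamV a tL q).1 = a q.1 from hAa _ hqt]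
    have h0 : sphereTangent q.2.2 (0 : EuclideanSpace ℝ (Fin 2)) = 0 := map_zero _
    simp only [h0, inner_zero_right, mul_zero, add_zero, mul_one]
    have : a q.1 ^ 2 * (1 * (1 / a q.1)) - ((a q.1 ^ 2 + 1) / 2 * (1 / a q.1) + 1 * a q.1) =
        -((a q.1 ^ 2 + 1) / (2 * a q.1)) := by
      field_simp
      ring
    rw [this]
    exact neg_neg_of_pos (by positivity)

end Main

end FLRW

/-! ### Proof of the theorem: second derivatives in λ -/

theorem corollary3p8 (tmax : ℝ) (a : ℝ → ℝ)
    (ha_smooth : ContDiffOn ℝ ∞ a (Iio tmax))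
    (ha_pos : ∀ t < tmax, 0 < a t)
    (h b : ℝ) (hh : 0 < h)
    (ha0 : (fun t => a t - (Real.exp (h * t) + b * Real.exp (3 * h * t)))
      =o[atBot] fun t => Real.exp (3 * h * t))
    (ha1 : (fun t => deriv a t - (h * Real.exp (h * t) + 3 * h * b * Real.exp (3 * h * t)))
      =o[atBot] fun t => Real.exp (3 * h * t))
    (ha2 : (fun t => deriv (deriv a) t -
        (h ^ 2 * Real.exp (h * t) + 9 * h ^ 2 * b * Real.exp (3 * h * t)))
      =o[atBot] fun t => Real.exp (3 * h * t)) :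
    Tendsto (fun t => deriv (FLRW.hubble a) t / a t ^ 2) atBot (𝓝 (4 * b * h ^ 2)) ∧
      ∀ tL < tmax, FLRW.AdmitsExtensionThroughLamZero a tmax tL 2 := by
  have ha0' : (fun t => a t - (1 * Real.exp (h * t) + b * Real.exp (3 * h * t)))
      =o[atBot] fun t => Real.exp (3 * h * t) := by simpa only [one_mul] using ha0
  have hlimH := FLRW.tendsto_deriv_hubble_div hh ha_pos ha0' ha1 ha_smooth ha2
  refine ⟨hlimH, fun tL htL => ?_⟩
  have hac := ha_smooth.continuousOn
  have hint : ∀ t < tmax, IntegrableOn a (Iic t) := fun t ht =>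
    FLRW.integrableOn_Iic_of_expansion hh ha0' hac ht
  have hl : ∀ t < tmax, HasDerivAt (FLRW.lam a) (a t) t := fun t ht =>
    FLRW.hasDerivAt_lam hac hint ht
  have hlim : Tendsto (FLRW.lam a) atBot (𝓝 0) := FLRW.tendsto_lam_atBot (hint tL htL)
  have hη : ∀ t < tmax, HasDerivAt (FLRW.conformalTime a tL) (1 / a t) t := fun t ht =>
    FLRW.hasDerivAt_conformalTime hac ha_pos htL ht
  have ha_lim : Tendsto a atBot (𝓝 0) := FLRW.tendsto_zero_of_expansion hh ha0'
  have haη := FLRW.tendsto_mul_conformalTime hac ha_pos htL hh ha0'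
  have hD := fun t (ht : t < tmax) => FLRW.hasDerivAt_hubble ha_pos ha_smooth ht
  have hHd : ∀ t < tmax, HasDerivAt (FLRW.hubble a) (deriv (FLRW.hubble a) t) t := fun t ht =>
    (hD t ht).2.2.differentiableAt.hasDerivAt
  have hHc : ContinuousOn (fun t => deriv (FLRW.hubble a) t / a t ^ 2) (Iio tmax) := by
    have hs1 : ContDiffOn ℝ ∞ (deriv a) (Iio tmax) :=
      ha_smooth.deriv_of_isOpen isOpen_Iio (by simp)
    have hs2 : ContDiffOn ℝ ∞ (deriv (deriv a)) (Iio tmax) :=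
      hs1.deriv_of_isOpen isOpen_Iio (by simp)
    have h1 : ContinuousOn (fun t => (deriv (deriv a) t * a t - deriv a t ^ 2) / a t ^ 2 / a t ^ 2)
        (Iio tmax) := by
      have hne : ∀ t ∈ Iio tmax, a t ^ 2 ≠ 0 := fun t ht => pow_ne_zero 2 (ha_pos t ht).ne'
      exact ((((hs2.continuousOn.mul hac).sub (hs1.continuousOn.pow 2)).div (hac.pow 2) hne).div
        (hac.pow 2) hne)
    exact h1.congr fun t ht => by rw [(hD t ht).2.2.deriv]
  have ht₁ : tmax - 1 < tmax := by linarith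
  -- da/dλ = H and d²a/dλ² = Ḣ/a, written as (Ḣ/a²) a to expose its limit 0.
  obtain ⟨A, hA, hAa⟩ := FLRW.exists_contDiff_two_extension hl ha_pos hac hlim (f := a)
    (f₁ := FLRW.hubble a) (f₂ := fun t => deriv (FLRW.hubble a) t / a t ^ 2 * a t)
    (fun t ht => (hD t ht).1.congr_deriv (by
      have := (ha_pos t ht).ne'
      rw [FLRW.hubble]
      field_simp))
    (fun t ht => (hHd t ht).congr_deriv (by
      have := (ha_pos t ht).ne'
      field_simp))
    (hHc.mul hac) (hlimH.mul ha_lim) ht₁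
  -- The second λ-derivative of a η is (Ḣ/a²)(a η), with limit -4bh.
  obtain ⟨G, hG, hGa⟩ := FLRW.exists_contDiff_two_extension hl ha_pos hac hlim
    (f := fun t => a t * FLRW.conformalTime a tL t)
    (f₁ := fun t => FLRW.hubble a t * FLRW.conformalTime a tL t + 1 / a t)
    (f₂ := fun t => deriv (FLRW.hubble a) t / a t ^ 2 * (a t * FLRW.conformalTime a tL t))
    (fun t ht => ((hD t ht).1.mul (hη t ht)).congr_deriv (by
      have := (ha_pos t ht).ne'
      rw [FLRW.hubble]
      field_simp))
    (fun t ht => (((hHd t ht).mul (hη t ht)).add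
      ((hasDerivAt_const t (1 : ℝ)).div (hD t ht).1 (ha_pos t ht).ne')).congr_deriv (by
        have := (ha_pos t ht).ne'
        rw [FLRW.hubble]
        field_simp
        ring))
    (hHc.mul (hac.mul fun t ht => (hη t ht).continuousAt.continuousWithinAt))
    (hlimH.mul haη) ht₁
  -- Values at λ = 0 are limits as t → -∞, by continuity and λ → 0.
  have hzero : ∀ {F f : ℝ → ℝ} {L : ℝ}, Continuous F →
      (∀ t < tmax - 1, F (FLRW.lam a t) = f t) → Tendsto f atBot (𝓝 L) → F 0 = L := by
    intro F f L hF hFf hf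
    refine tendsto_nhds_unique ((hF.tendsto 0).comp hlim) (hf.congr' ?_)
    filter_upwards [eventually_lt_atBot (tmax - 1)] with t ht using (hFf t ht).symm
  refine FLRW.admitsExtension_of_contDiff (k := 2) ha_pos hl hlim hη ht₁ hA hG hAa hGa
    (hzero hA.continuous hAa ha_lim) ?_
  rw [hzero hG.continuous hGa haη]
  exact neg_neg_of_pos (inv_pos.2 hh)
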